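/- Fix a positive integer $d$. For $0<p<1$, let $A\subseteq\mathbb{Z}_{\ge 0}^d$ be a $p$-random subset, i.e. each point of $\mathbb{Z}_{\ge 0}^d$ belongs to $A$ independently with probability $p$. Let $$\mathrm{FS}(A):=\{a_1+\cdots+a_k : k\in\mathbb{Z}_{\ge 0},\ a_1,\dots,a_k\in A \text{ distinct}\}$$ be its set of subset sums (the empty sum $0$ included), and for real $Z$ let $$\mathcal{R}_d(p,Z):=\{(x_1,\dots,x_d)\in\mathbb{Z}_{\ge 0}^d : (x_1+\log p^{-1})\cdots(x_d+\log p^{-1})\le Z\}.$$ Then there are constants $C,c_1,c_2>0$ depending only on $d$, and a function $\varepsilon(p)$ (depending only on $d$ and $p$) with $\varepsilon(p)\to 0$ as $p\to 0^+$, such that with probability tending to $1$ as $p\to 0^+$ all of the following hold: 1. $|\mathrm{FS}(A)\cap \mathcal{R}_d(p,C^{-1}p^{-1}(\log p^{-1})^{d+1})|\le \varepsilon(p)\,|\mathcal{R}_d(p,C^{-1}p^{-1}(\log p^{-1})^{d+1})|$; 2. $\mathbb{Z}_{\ge 0}^d\setminus \mathcal{R}_d(p,Cp^{-1}(\log p^{-1})^{d+1})\subseteq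 \mathrm{FS}(A)$; 3. the gap set $\mathbb{Z}_{\ge 0}^d\setminus \mathrm{FS}(A)$ is finite, and $$c_1\,p^{-1}(\log p^{-1})^{2d}\le |\mathbb{Z}_{\ge 0}^d\setminus \mathrm{FS}(A)|\le c_2\,p^{-1}(\log p^{-1})^{2d}.$$ -/

import Mathlib

open Filter Topology MeasureTheory

/-- The law of a `p`-random subset `A` of `ℤ_{≥0}^d`: each lattice point belongs to `A`
independently with probability `p`. -/
noncomputable def pRandomSubset (d : ℕ) (p : unitInterval) : Measure (Set (Fin d → ℕ)) :=
  ProbabilityTheory.setBernoulli Set.univ p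

/-- A property `E p A` of the density `p` and of a `p`-random subset `A` of `ℤ_{≥0}^d` holds with
high probability if its probability tends to `1` as `p → 0` (through positive values). -/
def WithHighProbability (d : ℕ) (E : unitInterval → Set (Fin d → ℕ) → Prop) : Prop :=
  Tendsto (fun p : unitInterval => pRandomSubset d p {A | E p A}) (𝓝[>] 0) (𝓝 1)

/-- `FS(A)`, the set of sums of finitely many distinct elements of `A` (the empty sum included). -/
def subsetSums {d : ℕ} (A : Set (Fin d → ℕ)) : Set (Fin d → ℕ) :=
  {x | ∃ F : Finset (Fin d → ℕ), (F : Set (Fin d → ℕ)) ⊆ A ∧ ∑ a ∈ F, a = x}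

/-- `R_d(p, Z)`, the set of lattice points of `ℤ_{≥0}^d` under the shifted hyperboloid
`(x₁ + log p⁻¹) ⋯ (x_d + log p⁻¹) = Z`. It is finite when `0 < p < 1` and `d ≥ 1`. -/
def hyperboloidRegion (d : ℕ) (p Z : ℝ) : Set (Fin d → ℕ) :=
  {x | ∏ i, ((x i : ℝ) + Real.log p⁻¹) ≤ Z}

/-- The scale `p⁻¹ (log p⁻¹)^{d+1}`. -/
noncomputable def gapScale (d : ℕ) (p : ℝ) : ℝ := p⁻¹ * Real.log p⁻¹ ^ (d + 1)

/-! Put L = log(1/p). Both sides of the threshold come from union bounds.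

Above the hyperboloid, fix x, let m be about 4L + ∑ log(x_j + 1), and take about 40·m·e^L points B
in the box ∏ [0, x_j/m], so that sums of at most m elements of B stay below x. Grow F ⊆ A ∩ B, with
|F| ≤ m, as long as each new element multiplies the number of subset sums by at least 3/2; let S be
the final set of sums. If x is missed, then either |S| ≥ |B|/4 and A avoids x - S outside F, or
growth has stalled and A avoids every b in B \ F for which S + b meets S in at most |S|/2 points. In
both cases the avoided set D has at least |B|/4 - |F| points and depends on A only through F
(`exists_subset_disjoint_avoidedSet`). Summing p^|F| (1-p)^|D| over small F gives e^{-3m}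
(`pRandomSubset_real_notMem_le`), which is summable over x.

Below it, the expected number of sets F ⊆ A with sum x is bounded by exponential tilting
(`sum_pow_card_sum_le_exp`). Deleting one element of F gains a factor p, and the total is at most
e^{-L/2}; Markov's inequality then shows that few points are hit.

Finally, both regions contain of order e^L L^{2d} lattice points, because each of d - 1 free
coordinates contributes a harmonic sum of order L to the scale e^L L^{d+1}. The gap set lies in the
larger region and contains at least half of the smaller one. -/

/-! ### Subset sums of finite sets -/

/-- The finite set of subset sums of a finite set. -/
def finsetSums {α : Type*} [AddCommMonoid α] [DecidableEq α] (F : Finset α) : Finset α :=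
  F.powerset.image fun G => ∑ a ∈ G, a

section FinsetSums

variable {α : Type*} [AddCommMonoid α] [DecidableEq α]

lemma mem_finsetSums {F : Finset α} {x : α} :
    x ∈ finsetSums F ↔ ∃ G ⊆ F, ∑ a ∈ G, a = x := by
  simp [finsetSums]

lemma finsetSums_nonempty (F : Finset α) : (finsetSums F).Nonempty :=
  ⟨0, mem_finsetSums.2 ⟨∅, by simp, by simp⟩⟩

lemma finsetSums_insert {F : Finset α} {a : α} (ha : a ∉ F) :
    finsetSums (insert a F) = finsetSums F ∪ (finsetSums F).image (· + a) := by
  rw [finsetSums, Finset.powerset_insert, Finset.image_union, Finset.image_image]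
  congr 1
  rw [finsetSums, Finset.image_image]
  refine Finset.image_congr fun G hG => ?_
  have : a ∉ G := fun h => ha (Finset.mem_powerset.1 hG h)
  simp [Finset.sum_insert this, add_comm]

variable [IsCancelAdd α]

/-- Inclusion-exclusion for S and S + a: an overlap of at most |S|/2 means growth by a factor of at
least 3/2. -/
lemma card_finsetSums_insert {F : Finset α} {a : α} (ha : a ∉ F) :
    (finsetSums (insert a F)).card + {s ∈ finsetSums F | s + a ∈ finsetSums F}.card
      = 2 * (finsetSums F).card := by
  rw [finsetSums_insert ha]
  set S := finsetSums F
  have hinj : Function.Injective fun s : α => s + a := add_left_injective a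
  have h1 : (S.image (· + a)).card = S.card := Finset.card_image_of_injective _ hinj
  have h2 : {s ∈ S | s + a ∈ S}.card = (S ∩ S.image (· + a)).card := by
    rw [← Finset.card_image_of_injective {s ∈ S | s + a ∈ S} hinj]
    congr 1
    ext z
    simp only [Finset.mem_image, Finset.mem_filter, Finset.mem_inter]
    constructor
    · rintro ⟨s, ⟨hs, hsa⟩, rfl⟩
      exact ⟨hsa, s, hs, rfl⟩
    · rintro ⟨hz, s, hs, rfl⟩
      exact ⟨s, ⟨hs, hz⟩, rfl⟩
  rw [h2, Finset.card_union_add_card_inter, h1, two_mul]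

/-- Double counting: for fixed s, the map b ↦ s + b injects the admissible b into S. Hence only
O(|S|) translates can overlap S heavily. -/
lemma sum_card_filter_add_mem_le (S B : Finset α) :
    ∑ b ∈ B, {s ∈ S | s + b ∈ S}.card ≤ S.card * S.card := by
  simp_rw [Finset.card_filter]
  rw [Finset.sum_comm, ← smul_eq_mul, ← Finset.sum_const]
  refine Finset.sum_le_sum fun s _ => ?_
  rw [← Finset.card_filter]
  refine Finset.card_le_card_of_injOn (fun b => s + b) (fun b hb => ?_)
    (add_right_injective s).injOn
  exact (Finset.mem_filter.1 hb).2

/-- If translating the subset sums of `F` by a further element still grows them substantially,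
`F` can be enlarged; so a subset of `A ∩ B` of maximal size among those with many subset sums is
either large or no element of `A ∩ B` outside of it yields substantial growth. -/
lemma exists_saturated_subset (A : Set α) (B : Finset α) (m : ℕ) :
    ∃ F ⊆ B, (F : Set α) ⊆ A ∧ F.card ≤ m ∧ 3 ^ F.card ≤ 2 ^ F.card * (finsetSums F).card ∧
      (F.card = m ∨ ∀ a ∈ B, a ∈ A → a ∉ F →
        (finsetSums F).card < 2 * {s ∈ finsetSums F | s + a ∈ finsetSums F}.card) := by
  classical
  -- The last condition is |FS(F)| ≥ (3/2)^|F|, cleared of denominators.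
  let P := B.powerset.filter fun F : Finset α => (F : Set α) ⊆ A ∧ F.card ≤ m ∧
    3 ^ F.card ≤ 2 ^ F.card * (finsetSums F).card
  have hP : P.Nonempty := ⟨∅, by
    simpa [P, Nat.one_le_iff_ne_zero] using (finsetSums_nonempty (∅ : Finset α)).ne_empty⟩
  obtain ⟨F, hF, hmax⟩ := Finset.exists_max_image P Finset.card hP
  simp only [P, Finset.mem_filter, Finset.mem_powerset] at hF hmax
  obtain ⟨hFB, hFA, hFm, hFS⟩ := hF
  refine ⟨F, hFB, hFA, hFm, hFS, ?_⟩
  by_contra! hcon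
  obtain ⟨hne, a, haB, haA, haF, hgrow⟩ := hcon
  have hcard := card_finsetSums_insert haF
  have hi : (insert a F).card = F.card + 1 := Finset.card_insert_of_notMem haF
  have := hmax (insert a F) ⟨Finset.insert_subset haB hFB, by
    rw [Finset.coe_insert]; exact Set.insert_subset haA hFA, by omega, by
    rw [hi, pow_succ, pow_succ]
    have h3 : 3 * (finsetSums F).card ≤ 2 * (finsetSums (insert a F)).card := by omega
    calc 3 ^ F.card * 3 ≤ (2 ^ F.card * (finsetSums F).card) * 3 := by gcongr
      _ = 2 ^ F.card * (3 * (finsetSums F).card) := by ring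
      _ ≤ 2 ^ F.card * (2 * (finsetSums (insert a F)).card) := by gcongr
      _ = _ := by ring⟩
  omega

end FinsetSums

/-! ### Sets that a missed point forces `A` to avoid -/

/-- The lattice box `∏ [0, n j]`. -/
def latticeBox {d : ℕ} (n : Fin d → ℕ) : Finset (Fin d → ℕ) :=
  Fintype.piFinset fun j => Finset.range (n j + 1)

lemma mem_latticeBox {d : ℕ} {n x : Fin d → ℕ} : x ∈ latticeBox n ↔ x ≤ n := by
  simp [latticeBox, Pi.le_def]

lemma card_latticeBox {d : ℕ} (n : Fin d → ℕ) : (latticeBox n).card = ∏ j, (n j + 1) := by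
  simp [latticeBox, Fintype.card_piFinset]

/-- A large set of points that a set avoids when it contains the saturated set `F ⊆ B` and does
not have `x` as a subset sum. -/
def avoidedSet {d : ℕ} (x : Fin d → ℕ) (B F : Finset (Fin d → ℕ)) : Finset (Fin d → ℕ) :=
  -- The split depends on |S| alone and not on `A`, so the union bound need only range over F.
  if 4 * (finsetSums F).card < B.card then
    {b ∈ B \ F | 2 * {s ∈ finsetSums F | s + b ∈ finsetSums F}.card ≤ (finsetSums F).card}
  else (finsetSums F).image (fun s => x - s) \ F

section Avoided

variable {d : ℕ} {x : Fin d → ℕ} {B F : Finset (Fin d → ℕ)}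

lemma disjoint_avoidedSet : Disjoint F (avoidedSet x B F) := by
  rw [Finset.disjoint_left]
  intro a ha h
  unfold avoidedSet at h
  split_ifs at h
  · simp_all
  · simp_all

lemma card_le_card_avoidedSet (hx : ∀ s ∈ finsetSums F, s ≤ x) :
    B.card ≤ 4 * ((avoidedSet x B F).card + F.card) := by
  unfold avoidedSet
  set S := finsetSums F with hS
  have hSpos : 0 < S.card := (finsetSums_nonempty F).card_pos
  split_ifs with h
  -- The bad elements `E` number at most 2|S| < |B|/2 by double counting.
  · set D := {b ∈ B \ F | 2 * {s ∈ S | s + b ∈ S}.card ≤ S.card}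
    set E := {b ∈ B \ F | ¬ 2 * {s ∈ S | s + b ∈ S}.card ≤ S.card}
    have h1 : D.card + E.card = (B \ F).card := Finset.card_filter_add_card_filter_not _
    have h2 : B.card ≤ (B \ F).card + F.card := by
      have := Finset.le_card_sdiff F B
      omega
    have h3 : E.card * S.card ≤ 2 * (S.card * S.card) := by
      calc E.card * S.card = ∑ b ∈ E, S.card := by simp
        _ ≤ ∑ b ∈ E, 2 * {s ∈ S | s + b ∈ S}.card :=
            Finset.sum_le_sum fun b hb => (not_le.1 (Finset.mem_filter.1 hb).2).le
        _ = 2 * ∑ b ∈ E, {s ∈ S | s + b ∈ S}.card := by rw [Finset.mul_sum]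
        _ ≤ _ := by gcongr; exact sum_card_filter_add_mem_le S E
    have h4 : E.card ≤ 2 * S.card := by
      rw [← mul_assoc] at h3
      exact Nat.le_of_mul_le_mul_right h3 hSpos
    omega
  · have hinj : (S.image (fun s => x - s)).card = S.card := by
      refine Finset.card_image_of_injOn fun s hs t ht hst => ?_
      have hs' := hx s hs
      have ht' := hx t ht
      funext j
      have := congrFun hst j
      have h1 := hs' j
      have h2 := ht' j
      simp only [Pi.sub_apply] at this
      simp only at h1 h2
      omega
    have := Finset.le_card_sdiff F (S.image (fun s => x - s))
    omega

/-- If `x` is not a subset sum of `A`, then `A` contains a small set `F ⊆ B` and avoids the large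
set `avoidedSet x B F`. -/
lemma exists_subset_disjoint_avoidedSet {A : Set (Fin d → ℕ)} {m : ℕ} (hxA : x ∉ subsetSums A)
    (hm : 2 ^ m * B.card ≤ 4 * 3 ^ m)
    (hx : ∀ F ⊆ B, F.card ≤ m → ∀ s ∈ finsetSums F, s ≤ x) :
    ∃ F ⊆ B, F.card ≤ m ∧ (F : Set (Fin d → ℕ)) ⊆ A ∧
      Disjoint (avoidedSet x B F : Set (Fin d → ℕ)) A := by
  obtain ⟨F, hFB, hFA, hFm, hFS, hF⟩ := exists_saturated_subset A B m
  refine ⟨F, hFB, hFm, hFA, ?_⟩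
  rw [Set.disjoint_left]
  intro a ha haA
  rw [Finset.mem_coe] at ha
  unfold avoidedSet at ha
  split_ifs at ha with h
  · simp only [Finset.mem_filter, Finset.mem_sdiff] at ha
    rcases hF with hF | hF
    -- A full F with |F| = m has at least (3/2)^m ≥ |B|/4 sums, which is incompatible with this
    -- branch.
    · rw [hF] at hFS
      have : 2 ^ m * (4 * (finsetSums F).card) < 2 ^ m * B.card := by gcongr
      linarith
    · have := hF a ha.1.1 haA ha.1.2
      omega
  · simp only [Finset.mem_sdiff, Finset.mem_image] at ha
    obtain ⟨⟨s, hs, rfl⟩, haF⟩ := ha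
    have hsx := hx F hFB hFm s hs
    obtain ⟨G, hG, rfl⟩ := mem_finsetSums.1 hs
    refine hxA ⟨insert (x - ∑ a ∈ G, a) G, ?_, ?_⟩
    · rw [Finset.coe_insert]
      exact Set.insert_subset haA ((Finset.coe_subset.2 hG).trans hFA)
    · rw [Finset.sum_insert fun h => haF (hG h)]
      exact tsub_add_cancel_of_le hsx

lemma le_of_mem_finsetSums_of_subset_latticeBox {m : ℕ}
    (hB : B ⊆ latticeBox fun j => x j / m) (hF : F ⊆ B) (hFm : F.card ≤ m) :
    ∀ s ∈ finsetSums F, s ≤ x := by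
  intro s hs j
  obtain ⟨G, hG, rfl⟩ := mem_finsetSums.1 hs
  rw [Finset.sum_apply]
  calc ∑ a ∈ G, a j ≤ G.card * (x j / m) := by
        rw [← smul_eq_mul]
        exact Finset.sum_le_card_nsmul _ _ _ fun a ha => mem_latticeBox.1 (hB (hF (hG ha))) j
    _ ≤ m * (x j / m) := by
        gcongr
        exact (Finset.card_le_card hG).trans hFm
    _ ≤ x j := Nat.mul_div_le _ _

end Avoided

/-! ### Probabilities -/

instance (d : ℕ) (p : unitInterval) : IsProbabilityMeasure (pRandomSubset d p) := by
  unfold pRandomSubset; infer_instance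

lemma pRandomSubset_real_subset_disjoint {d : ℕ} (p : unitInterval)
    {F D : Finset (Fin d → ℕ)} (h : Disjoint F D) :
    (pRandomSubset d p).real {A | (F : Set (Fin d → ℕ)) ⊆ A ∧ Disjoint (D : Set (Fin d → ℕ)) A}
      = (p : ℝ) ^ F.card * (1 - (p : ℝ)) ^ D.card := by
  classical
  -- In the product space the event is a cylinder: coordinates in F are true, those in D are false.
  have hset : ((fun q : (Fin d → ℕ) → Prop => {i | q i}) ⁻¹'
      {A | (F : Set (Fin d → ℕ)) ⊆ A ∧ Disjoint (D : Set (Fin d → ℕ)) A})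
      = Set.pi ((F ∪ D : Finset (Fin d → ℕ)) : Set (Fin d → ℕ))
        fun i => if i ∈ F then {True} else {False} := by
    ext q
    simp only [Set.mem_preimage, Set.mem_ofPred_eq, Set.mem_pi, Finset.coe_union, Set.mem_union,
      Finset.mem_coe, Set.disjoint_left, Set.subset_def]
    constructor
    · rintro ⟨h1, h2⟩ i hi
      by_cases hF : i ∈ F
      · simpa [hF] using h1 i hF
      · simpa [hF] using h2 (hi.resolve_left hF)
    · intro hq
      refine ⟨fun i hi => by simpa [hi] using hq i (Or.inl hi), fun i hi => ?_⟩
      have hF : i ∉ F := fun hF => Finset.disjoint_left.1 h hF hi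
      simpa [hF] using hq i (Or.inr hi)
  rw [measureReal_def, pRandomSubset, ProbabilityTheory.setBernoulli_apply', hset,
    Measure.infinitePi_pi _ (fun i _ => .of_discrete), Finset.prod_union h, ENNReal.toReal_mul,
    ENNReal.toReal_prod, ENNReal.toReal_prod]
  congr 1
  · rw [← Finset.prod_const]
    refine Finset.prod_congr rfl fun i hi => ?_
    simp [hi]
  · rw [← Finset.prod_const]
    refine Finset.prod_congr rfl fun i hi => ?_
    have hF : i ∉ F := fun hF => Finset.disjoint_left.1 h hF hi
    simp [hF]

lemma pRandomSubset_real_subset {d : ℕ} (p : unitInterval) (F : Finset (Fin d → ℕ)) :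
    (pRandomSubset d p).real {A | (F : Set (Fin d → ℕ)) ⊆ A} = (p : ℝ) ^ F.card := by
  simpa using pRandomSubset_real_subset_disjoint p (Finset.disjoint_empty_right F)

/-- The weight 32^(m - |F|) ≥ 1 trades a factor 32^m for an exponent p|B|/32, small against the gain
p|B|/4 from avoidance. -/
lemma sum_pow_card_le_exp {α : Type*} [DecidableEq α] (B : Finset α) (m : ℕ) {p : ℝ}
    (hp : 0 ≤ p) :
    ∑ F ∈ B.powerset with F.card ≤ m, p ^ F.card ≤ 32 ^ m * Real.exp (p * B.card / 32) := by
  calc ∑ F ∈ B.powerset with F.card ≤ m, p ^ F.card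
      ≤ ∑ F ∈ B.powerset with F.card ≤ m, 32 ^ m * (p / 32) ^ F.card := by
        refine Finset.sum_le_sum fun F hF => ?_
        have hFm := (Finset.mem_filter.1 hF).2
        calc p ^ F.card = 32 ^ F.card * (p / 32) ^ F.card := by rw [← mul_pow]; congr 1; ring
          _ ≤ 32 ^ m * (p / 32) ^ F.card := by gcongr; norm_num
    _ ≤ ∑ F ∈ B.powerset, 32 ^ m * (p / 32) ^ F.card :=
        Finset.sum_le_sum_of_subset_of_nonneg (Finset.filter_subset _ _)
          fun _ _ _ => by positivity
    _ = 32 ^ m * (p / 32 + 1) ^ B.card := by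
        rw [← Finset.mul_sum, ← Finset.sum_pow_mul_eq_add_pow]
        simp
    _ ≤ 32 ^ m * Real.exp (p * B.card / 32) := by
        have h : p * B.card / 32 = B.card * (p / 32) := by ring
        rw [h, Real.exp_nat_mul]
        gcongr
        exact Real.add_one_le_exp _

lemma measureReal_le_sum_of_forall_exists {Ω ι : Type*} [MeasurableSpace Ω] (μ : Measure Ω)
    [IsFiniteMeasure μ] {E : Set Ω} (s : Finset ι) (f : ι → Set Ω)
    (h : ∀ ω ∈ E, ∃ i ∈ s, ω ∈ f i) : μ.real E ≤ ∑ i ∈ s, μ.real (f i) := by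
  refine le_trans (measureReal_mono (fun ω hω => ?_) (measure_ne_top μ _)) (measureReal_biUnion_finset_le s f)
  obtain ⟨i, hi, hω'⟩ := h ω hω
  exact Set.mem_biUnion hi hω'

lemma pRandomSubset_real_notMem_le {d : ℕ} (p : unitInterval) {x : Fin d → ℕ} {m : ℕ}
    {B : Finset (Fin d → ℕ)} (hB : B ⊆ latticeBox fun j => x j / m)
    (hm : 2 ^ m * B.card ≤ 4 * 3 ^ m) (hpB : 40 * (m : ℝ) ≤ p * B.card) :
    (pRandomSubset d p).real {A | x ∉ subsetSums A} ≤ Real.exp (-3 * m) := by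
  have hp0 : (0 : ℝ) ≤ p := p.2.1
  have hp1 : (p : ℝ) ≤ 1 := p.2.2
  have hx : ∀ F ⊆ B, F.card ≤ m → ∀ s ∈ finsetSums F, s ≤ x := fun F hF hFm =>
    le_of_mem_finsetSums_of_subset_latticeBox hB hF hFm
  calc (pRandomSubset d p).real {A | x ∉ subsetSums A}
      ≤ ∑ F ∈ B.powerset with F.card ≤ m, (pRandomSubset d p).real
          {A | (F : Set (Fin d → ℕ)) ⊆ A ∧ Disjoint (avoidedSet x B F : Set (Fin d → ℕ)) A} := by
        refine measureReal_le_sum_of_forall_exists _ _ _ fun A hA => ?_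
        obtain ⟨F, hFB, hFm, hF⟩ := exists_subset_disjoint_avoidedSet hA hm hx
        exact ⟨F, by simp [hFB, hFm], hF⟩
    _ ≤ ∑ F ∈ B.powerset with F.card ≤ m,
          (p : ℝ) ^ F.card * Real.exp (-(p * (B.card / 4 - m))) := by
        refine Finset.sum_le_sum fun F hF => ?_
        simp only [Finset.mem_filter, Finset.mem_powerset] at hF
        rw [pRandomSubset_real_subset_disjoint p disjoint_avoidedSet]
        gcongr
        have h1 : (B.card : ℝ) ≤ 4 * ((avoidedSet x B F).card + F.card) := by
          exact_mod_cast card_le_card_avoidedSet (hx F hF.1 hF.2)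
        have h2 : (F.card : ℝ) ≤ m := by exact_mod_cast hF.2
        calc (1 - (p : ℝ)) ^ (avoidedSet x B F).card
            ≤ Real.exp (-p) ^ (avoidedSet x B F).card := by
              gcongr
              exact Real.one_sub_le_exp_neg _
          _ = Real.exp (-(p * (avoidedSet x B F).card)) := by
              rw [← Real.exp_nat_mul]; ring_nf
          _ ≤ _ := by
              gcongr
              linarith
    _ ≤ 32 ^ m * Real.exp (p * B.card / 32) * Real.exp (-(p * (B.card / 4 - m))) := by
        rw [← Finset.sum_mul]
        gcongr
        exact sum_pow_card_le_exp B m hp0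
    _ ≤ Real.exp (7 / 2 * m) * Real.exp (p * B.card / 32) *
          Real.exp (-(p * (B.card / 4 - m))) := by
        gcongr
        rw [mul_comm, Real.exp_nat_mul]
        gcongr
        rw [← Real.log_le_iff_le_exp (by norm_num)]
        have : (32 : ℝ) = 2 ^ 5 := by norm_num
        rw [this, Real.log_pow]
        have := Real.log_two_lt_d9
        push_cast
        linarith
    _ ≤ Real.exp (-3 * m) := by
        rw [← Real.exp_add, ← Real.exp_add]
        gcongr
        -- With p|B| ≥ 40m the exponent is at most (7/2 + 1 - 40·7/32)m = -(17/4)m.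
        have : (p : ℝ) * m ≤ m := mul_le_of_le_one_left (by positivity) hp1
        nlinarith

/-! ### First-moment bound for hitting a point -/

open Classical in
/-- Removing one element from a nonempty set with sum `x` loses no information. -/
lemma sum_pow_card_le_mul_sum {d : ℕ} {x : Fin d → ℕ} (hx : x ≠ 0) {p : ℝ} (hp : 0 ≤ p) :
    ∑ F ∈ (latticeBox x).powerset with ∑ a ∈ F, a = x, p ^ F.card
      ≤ p * ∑ F ∈ (latticeBox x).powerset with ∑ a ∈ F, a ≤ x, p ^ F.card := by
  set T := (latticeBox x).powerset.filter fun F : Finset (Fin d → ℕ) => ∑ a ∈ F, a = x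
  have hne : ∀ F ∈ T, ∃ a, a ∈ F := fun F hF => by
    by_contra! hcon
    rw [Finset.eq_empty_of_forall_notMem hcon] at hF
    exact hx (by simpa [T] using (Finset.mem_filter.1 hF).2.symm)
  choose! g hg using hne
  have hsum : ∀ F ∈ T, g F + ∑ a ∈ F.erase (g F), a = x := fun F hF => by
    rw [Finset.add_sum_erase F (fun a => a) (hg F hF)]
    exact (Finset.mem_filter.1 hF).2
  -- The deleted element is recovered as x minus the remaining sum.
  have hinj : Set.InjOn (fun F : Finset (Fin d → ℕ) => F.erase (g F)) T := by
    intro F hF G hG hFG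
    simp only at hFG
    have h1 := hsum F hF
    have h2 := hsum G hG
    rw [← hFG, ← h1] at h2
    have h3 : g G = g F := add_right_cancel h2
    rw [← Finset.insert_erase (hg F hF), hFG, ← h3, Finset.insert_erase (hg G hG)]
  calc ∑ F ∈ T, p ^ F.card = ∑ F ∈ T, p * p ^ (F.erase (g F)).card := by
        refine Finset.sum_congr rfl fun F hF => ?_
        rw [← pow_succ', Finset.card_erase_add_one (hg F hF)]
    _ = p * ∑ G ∈ T.image (fun F => F.erase (g F)), p ^ G.card := by
        rw [Finset.sum_image hinj, Finset.mul_sum]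
    _ ≤ _ := by
        gcongr
        intro G hG
        obtain ⟨F, hF, rfl⟩ := Finset.mem_image.1 hG
        have hFT := Finset.mem_filter.1 hF
        refine Finset.mem_filter.2 ⟨Finset.mem_powerset.2 ?_, ?_⟩
        · exact (Finset.erase_subset _ _).trans (Finset.mem_powerset.1 hFT.1)
        · exact (hsum F hF) ▸ le_add_self

lemma sum_latticeBox_exp_le {d : ℕ} (x : Fin d → ℕ) {t : Fin d → ℝ} (ht : ∀ j, 0 < t j) :
    ∑ a ∈ latticeBox x, Real.exp (-∑ j, t j * a j) ≤ ∏ j, (1 - Real.exp (-t j))⁻¹ := by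
  have h : ∀ a : Fin d → ℕ, Real.exp (-∑ j, t j * a j) = ∏ j, Real.exp (-t j) ^ a j := fun a => by
    rw [← Finset.sum_neg_distrib, Real.exp_sum]
    refine Finset.prod_congr rfl fun j _ => ?_
    rw [← Real.exp_nat_mul]; ring_nf
  simp_rw [h]
  rw [latticeBox, ← Finset.prod_univ_sum]
  refine Finset.prod_le_prod (fun j _ => by positivity) fun j _ => ?_
  have h1 : Real.exp (-t j) < 1 := by
    rw [Real.exp_lt_one_iff]
    linarith [ht j]
  rw [← tsum_geometric_of_lt_one (Real.exp_pos _).le h1]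
  exact (summable_geometric_of_lt_one (Real.exp_pos _).le h1).sum_le_tsum _
    fun _ _ => by positivity

-- Rankin's trick: the constraint ∑ F ≤ x is relaxed to the weight exp(t·(x - ∑ F)) ≥ 1, after which
-- the sum over F factorises over the points of the box.
open Classical in
lemma sum_pow_card_sum_le_exp {d : ℕ} (x : Fin d → ℕ) {p : ℝ} (hp : 0 ≤ p) {t : Fin d → ℝ}
    (ht : ∀ j, 0 < t j) :
    ∑ F ∈ (latticeBox x).powerset with ∑ a ∈ F, a ≤ x, p ^ F.card
      ≤ Real.exp (∑ j, t j * x j + p * ∏ j, (1 - Real.exp (-t j))⁻¹) := by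
  set w : (Fin d → ℕ) → ℝ := fun a => ∑ j, t j * a j with hw
  have hwsum : ∀ F : Finset (Fin d → ℕ), w (∑ a ∈ F, a) = ∑ a ∈ F, w a := fun F => by
    simp only [hw, Finset.sum_apply, Nat.cast_sum, Finset.mul_sum]
    exact Finset.sum_comm
  calc ∑ F ∈ (latticeBox x).powerset with ∑ a ∈ F, a ≤ x, p ^ F.card
      ≤ ∑ F ∈ (latticeBox x).powerset with ∑ a ∈ F, a ≤ x,
          Real.exp (w x) * ∏ a ∈ F, p * Real.exp (-w a) := by
        refine Finset.sum_le_sum fun F hF => ?_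
        have hle := (Finset.mem_filter.1 hF).2
        have : w (∑ a ∈ F, a) ≤ w x :=
          Finset.sum_le_sum fun j _ => by
            have := ht j
            gcongr
            exact hle j
        rw [Finset.prod_mul_distrib, Finset.prod_const, ← Real.exp_sum, Finset.sum_neg_distrib,
          ← hwsum, mul_left_comm, ← Real.exp_add]
        refine le_mul_of_one_le_right (by positivity) (Real.one_le_exp (by linarith))
    _ ≤ ∑ F ∈ (latticeBox x).powerset, Real.exp (w x) * ∏ a ∈ F, p * Real.exp (-w a) :=
        Finset.sum_le_sum_of_subset_of_nonneg (Finset.filter_subset _ _)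
          fun _ _ _ => by positivity
    _ = Real.exp (w x) * ∏ a ∈ latticeBox x, (1 + p * Real.exp (-w a)) := by
        rw [← Finset.mul_sum, Finset.prod_one_add]
    _ ≤ Real.exp (w x) * ∏ a ∈ latticeBox x, Real.exp (p * Real.exp (-w a)) := by
        gcongr with a
        rw [add_comm]
        exact Real.add_one_le_exp _
    _ = Real.exp (w x + p * ∑ a ∈ latticeBox x, Real.exp (-w a)) := by
        rw [← Real.exp_sum, ← Real.exp_add, Finset.mul_sum]
    _ ≤ _ := by
        gcongr
        exact sum_latticeBox_exp_le x ht

lemma pRandomSubset_real_mem_le {d : ℕ} (p : unitInterval) {x : Fin d → ℕ} (hx : x ≠ 0)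
    {t : Fin d → ℝ} (ht : ∀ j, 0 < t j) :
    (pRandomSubset d p).real {A | x ∈ subsetSums A}
      ≤ p * Real.exp (∑ j, t j * x j + p * ∏ j, (1 - Real.exp (-t j))⁻¹) := by
  classical
  calc (pRandomSubset d p).real {A | x ∈ subsetSums A}
      ≤ ∑ F ∈ (latticeBox x).powerset with ∑ a ∈ F, a = x,
          (pRandomSubset d p).real {A | (F : Set (Fin d → ℕ)) ⊆ A} := by
        refine measureReal_le_sum_of_forall_exists _ _ _ fun A hA => ?_
        obtain ⟨F, hFA, hF⟩ := hA
        refine ⟨F, ?_, hFA⟩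
        simp only [Finset.mem_filter, Finset.mem_powerset]
        exact ⟨fun a ha => mem_latticeBox.2 (hF ▸
          Finset.single_le_sum_of_canonicallyOrdered (f := fun a => a) ha),
          hF⟩
    _ = ∑ F ∈ (latticeBox x).powerset with ∑ a ∈ F, a = x, (p : ℝ) ^ F.card := by
        simp_rw [pRandomSubset_real_subset]
    _ ≤ _ := (sum_pow_card_le_mul_sum hx p.2.1).trans
        (mul_le_mul_of_nonneg_left (sum_pow_card_sum_le_exp x p.2.1 ht) p.2.1)

/-! ### Points above the shifted hyperboloid -/

/-- Used with τ the ratio of ∏ (x_j + L) to e^L L^{d+1}: m/L grows only like log τ, so a large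
constant C absorbs all powers of m. -/
lemma exists_forall_mul_add_log_pow_le (K a : ℝ) (n : ℕ) (hK : 0 ≤ K) (ha : 0 ≤ a) :
    ∃ C : ℝ, 1 ≤ C ∧ ∀ τ ≥ C, K * (a + Real.log τ) ^ n ≤ τ := by
  have h1 : ∀ᶠ τ : ℝ in atTop, a ≤ Real.log τ := Real.tendsto_log_atTop.eventually_ge_atTop a
  have h2 : ∀ᶠ τ : ℝ in atTop, ‖Real.log τ ^ n‖ ≤ (1 / (K * 2 ^ n + 1)) * ‖id τ‖ :=
    Real.isLittleO_pow_log_id_atTop.bound (by positivity)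
  obtain ⟨C, hC⟩ := eventually_atTop.1 ((h1.and h2).and (eventually_ge_atTop 1))
  refine ⟨max C 1, le_max_right _ _, fun τ hτ => ?_⟩
  obtain ⟨⟨h1, h2⟩, h3⟩ := hC τ ((le_max_left _ _).trans hτ)
  have hlog : 0 ≤ Real.log τ := ha.trans h1
  rw [Real.norm_of_nonneg (by positivity), id, Real.norm_of_nonneg (by linarith)] at h2
  calc K * (a + Real.log τ) ^ n ≤ K * (2 * Real.log τ) ^ n := by gcongr; linarith
    _ = K * 2 ^ n * Real.log τ ^ n := by rw [mul_pow]; ring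
    _ ≤ (K * 2 ^ n + 1) * (1 / (K * 2 ^ n + 1) * τ) := by gcongr; linarith
    _ = τ := by field_simp

lemma eventually_two_pow_mul_le :
    ∀ᶠ m : ℕ in atTop, ∀ L : ℝ, 4 * L ≤ m → (2 : ℝ) ^ m * (41 * m * Real.exp L) ≤ 4 * 3 ^ m := by
  have h := (tendsto_self_mul_const_pow_of_lt_one (r := 8 / 9) (by norm_num)
    (by norm_num)).eventually_le_const (show (0 : ℝ) < 4 / 41 by norm_num)
  filter_upwards [h] with m hm L hL
  have h1 : Real.exp L ≤ (4 / 3) ^ m := by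
    have : Real.exp (1 / 4) ≤ 4 / 3 := by
      have h4 : Real.exp (1 / 4) ^ 4 ≤ (4 / 3) ^ 4 := by
        rw [← Real.exp_nat_mul]
        have := Real.exp_one_lt_d9
        norm_num
        linarith
      exact le_of_pow_le_pow_left₀ (by norm_num) (by norm_num) h4
    calc Real.exp L ≤ Real.exp (m * (1 / 4)) := by gcongr; linarith
      _ = Real.exp (1 / 4) ^ m := Real.exp_nat_mul _ _
      _ ≤ _ := by gcongr
  calc (2 : ℝ) ^ m * (41 * m * Real.exp L) ≤ 2 ^ m * (41 * m * (4 / 3) ^ m) := by gcongr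
    _ = 41 * (m * (8 / 9) ^ m) * 3 ^ m := by
        have : (2 : ℝ) ^ m * (4 / 3) ^ m = (8 / 9) ^ m * 3 ^ m := by
          rw [← mul_pow, ← mul_pow]; norm_num
        linear_combination 41 * m * this
    _ ≤ 41 * (4 / 41) * 3 ^ m := by gcongr
    _ = _ := by ring

/-- The shift by L is harmless here: a coordinate below m still contributes one layer to the box,
and L ≤ m. -/
lemma div_two_mul_pow_le_prod {d : ℕ} (x : Fin d → ℕ) {m : ℕ} (hm : 0 < m) {L : ℝ} (hL : 0 ≤ L)
    (hLm : L ≤ m) :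
    (∏ j, ((x j : ℝ) + L)) / (2 * m) ^ d ≤ ∏ j, ((x j / m : ℕ) + 1 : ℝ) := by
  have : (2 * (m : ℝ)) ^ d = ∏ _j : Fin d, 2 * (m : ℝ) := by simp
  rw [this, ← Finset.prod_div_distrib]
  refine Finset.prod_le_prod (fun j _ => by positivity) fun j _ => ?_
  have hm' : (0 : ℝ) < m := by exact_mod_cast hm
  rw [div_le_iff₀ (by positivity)]
  have h1 : (x j : ℝ) < m * ((x j / m : ℕ) + 1) := by exact_mod_cast Nat.lt_mul_div_succ (x j) hm
  have h2 : (0 : ℝ) ≤ m * (x j / m : ℕ) := by positivity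
  linarith

lemma sum_log_add_one_le_log_prod {d : ℕ} (x : Fin d → ℕ) {L : ℝ} (hL : 1 ≤ L) :
    ∑ j, Real.log ((x j : ℝ) + 1) ≤ Real.log (∏ j, ((x j : ℝ) + L)) := by
  rw [Real.log_prod fun j _ => by positivity]
  gcongr

/-- The probability that a point above the shifted hyperboloid is missed by the subset sums of a
random set. -/
lemma exists_forall_pRandomSubset_real_notMem_le (d : ℕ) :
    ∃ C : ℝ, 0 < C ∧ ∃ L₀ : ℝ, 1 ≤ L₀ ∧ ∀ (p : unitInterval) (L : ℝ), L₀ ≤ L →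
      (p : ℝ) = Real.exp (-L) → ∀ x : Fin d → ℕ,
        C * (Real.exp L * L ^ (d + 1)) < ∏ j, ((x j : ℝ) + L) →
        (pRandomSubset d p).real {A | x ∉ subsetSums A}
          ≤ Real.exp (-12 * L) * ∏ j, (((x j : ℝ) + 1) ^ 3)⁻¹ := by
  -- 41 comes from |B| ≤ 41·m·e^L, 2^d from the box volume, and d + 7 from m ≤ L(d + 7 + log τ).
  obtain ⟨C, hC1, hC⟩ := exists_forall_mul_add_log_pow_le (41 * 2 ^ d) (d + 7) (d + 1)
    (by positivity) (by positivity)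
  obtain ⟨M, hM⟩ := eventually_atTop.1 eventually_two_pow_mul_le
  refine ⟨C, by linarith, max M 1, le_max_right _ _, fun p L hL₀ hpL x hx => ?_⟩
  have hML : (M : ℝ) ≤ L := (le_max_left _ _).trans hL₀
  have hL1 : 1 ≤ L := (le_max_right _ _).trans hL₀
  set Q := ∏ j, ((x j : ℝ) + L) with hQ
  have hQpos : 0 < Q := Finset.prod_pos fun j _ => by positivity
  set σ := ∑ j, Real.log ((x j : ℝ) + 1) with hσ
  have hσ0 : 0 ≤ σ := Finset.sum_nonneg fun j _ => Real.log_nonneg (by simp)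
  -- Then e^{-3m} supplies both e^{-12L} and the summable weight ∏ (x_j + 1)^{-3}.
  set m := ⌈4 * L + σ⌉₊ with hmdef
  have hm_ge : 4 * L + σ ≤ m := Nat.le_ceil _
  have hm_lt : (m : ℝ) < 4 * L + σ + 1 := Nat.ceil_lt_add_one (by positivity)
  have hm1 : (1 : ℝ) ≤ m := by linarith
  have hmpos : 0 < m := by exact_mod_cast (by linarith : (0 : ℝ) < m)
  have hMm : M ≤ m := by exact_mod_cast (by linarith : (M : ℝ) ≤ m)
  have hexpL : 1 ≤ Real.exp L := Real.one_le_exp (by linarith)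
  set b := ⌈40 * m * Real.exp L⌉₊ with hb
  have hb_ge : 40 * m * Real.exp L ≤ b := Nat.le_ceil _
  have hb_le : (b : ℝ) ≤ 41 * m * Real.exp L := by
    have h1 : (b : ℝ) < 40 * m * Real.exp L + 1 := Nat.ceil_lt_add_one (by positivity)
    nlinarith
  have hmle : (m : ℝ) ≤ L * (d + 7 + Real.log (Q / (Real.exp L * L ^ (d + 1)))) := by
    have h1 : σ ≤ Real.log Q := sum_log_add_one_le_log_prod x hL1
    have h2 : Real.log (Q / (Real.exp L * L ^ (d + 1)))
        = Real.log Q - (L + (d + 1) * Real.log L) := by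
      rw [Real.log_div hQpos.ne' (by positivity), Real.log_mul (by positivity) (by positivity),
        Real.log_exp, Real.log_pow]
      push_cast; ring
    have h3 : Real.log L ≤ L := Real.log_le_self (by linarith)
    have h4 : (0 : ℝ) ≤ Real.log (Q / (Real.exp L * L ^ (d + 1))) := by
      refine Real.log_nonneg ?_
      rw [le_div_iff₀ (by positivity), one_mul]
      exact (le_mul_of_one_le_left (by positivity) hC1).trans hx.le
    have h5 : Real.log Q ≤ Real.log (Q / (Real.exp L * L ^ (d + 1))) + L + (d + 1) * L := by
      rw [h2]
      have : ((d : ℝ) + 1) * Real.log L ≤ (d + 1) * L := by gcongr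
      linarith
    nlinarith
  have hbcard : b ≤ (latticeBox fun j => x j / m).card := by
    rw [card_latticeBox]
    have hτ : C ≤ Q / (Real.exp L * L ^ (d + 1)) := by
      rw [le_div_iff₀ (by positivity)]
      exact hx.le
    have h1 := hC _ hτ
    have h2 : 41 * m * Real.exp L ≤ Q / (2 * m) ^ d := by
      rw [le_div_iff₀ (by positivity)]
      have h3 := mul_le_mul_of_nonneg_right h1
        (show 0 ≤ Real.exp L * L ^ (d + 1) by positivity)
      rw [div_mul_cancel₀ _ (by positivity)] at h3
      refine le_trans ?_ h3
      calc 41 * m * Real.exp L * (2 * m) ^ d = 41 * 2 ^ d * (m : ℝ) ^ (d + 1) * Real.exp L := by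
            rw [mul_pow]; ring
        _ ≤ 41 * 2 ^ d * (L * (d + 7 + Real.log (Q / (Real.exp L * L ^ (d + 1))))) ^ (d + 1)
              * Real.exp L := by gcongr
        _ = _ := by rw [mul_pow]; ring
    have h3 := div_two_mul_pow_le_prod x hmpos (by linarith : 0 ≤ L) (by linarith)
    exact_mod_cast hb_le.trans (h2.trans h3)
  -- The whole box may be too large for 2^m |B| ≤ 4·3^m, so exactly b points are kept.
  obtain ⟨B, hBsub, hBcard⟩ := Finset.exists_subset_card_eq hbcard
  have hmain := pRandomSubset_real_notMem_le p hBsub (by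
    rw [hBcard]
    have h1 := hM m hMm L (by linarith)
    have h2 : (2 : ℝ) ^ m * b ≤ 4 * 3 ^ m := le_trans (by gcongr) h1
    exact_mod_cast h2) (by
    rw [hBcard, hpL]
    calc 40 * (m : ℝ) = Real.exp (-L) * (40 * m * Real.exp L) := by
          rw [Real.exp_neg]; field_simp
      _ ≤ _ := by gcongr)
  refine hmain.trans ?_
  calc Real.exp (-3 * m) ≤ Real.exp (-12 * L + -3 * σ) := by
        gcongr
        linarith
    _ = _ := by
      rw [Real.exp_add, hσ, Finset.mul_sum, Real.exp_sum]
      congr 1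
      refine Finset.prod_congr rfl fun j _ => ?_
      have : -3 * Real.log ((x j : ℝ) + 1) = -((3 : ℕ) * Real.log ((x j : ℝ) + 1)) := by
        push_cast; ring
      rw [this, Real.exp_neg, Real.exp_nat_mul, Real.exp_log (by positivity)]

lemma summable_prod_inv_pow_three (d : ℕ) :
    Summable fun x : Fin d → ℕ => ∏ j, (((x j : ℝ) + 1) ^ 3)⁻¹ := by
  have h1 : Summable fun n : ℕ => (((n : ℝ) + 1) ^ 3)⁻¹ := by
    have := (summable_nat_add_iff 1).2 (Real.summable_nat_pow_inv.2 (by norm_num : 1 < 3))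
    simpa using this
  refine summable_of_sum_le (c := ∏ _j : Fin d, ∑' n : ℕ, (((n : ℝ) + 1) ^ 3)⁻¹)
    (fun x => by positivity) fun s => ?_
  have hs : s ⊆ latticeBox (s.sup id) := fun x hx => mem_latticeBox.2 (Finset.le_sup (f := id) hx)
  calc ∑ x ∈ s, ∏ j, (((x j : ℝ) + 1) ^ 3)⁻¹
      ≤ ∑ x ∈ latticeBox (s.sup id), ∏ j, (((x j : ℝ) + 1) ^ 3)⁻¹ :=
        Finset.sum_le_sum_of_subset_of_nonneg hs fun _ _ _ => by positivity
    _ = ∏ j, ∑ n ∈ Finset.range (s.sup id j + 1), (((n : ℝ) + 1) ^ 3)⁻¹ :=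
        (Finset.prod_univ_sum (fun j => Finset.range (s.sup id j + 1))
          fun _ n => (((n : ℝ) + 1) ^ 3)⁻¹).symm
    _ ≤ _ := Finset.prod_le_prod (fun j _ => by positivity)
        fun j _ => h1.sum_le_tsum _ fun _ _ => by positivity

/-- With high probability the subset sums cover everything above the shifted hyperboloid. -/
lemma exists_forall_pRandomSubset_real_not_compl_subset_le (d : ℕ) :
    ∃ C : ℝ, 0 < C ∧ ∃ L₀ : ℝ, ∃ W : ℝ, ∀ (p : unitInterval) (L : ℝ), L₀ ≤ L →
      (p : ℝ) = Real.exp (-L) →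
        (pRandomSubset d p).real
          {A | ¬ {x : Fin d → ℕ | ∏ j, ((x j : ℝ) + L) ≤ C * (Real.exp L * L ^ (d + 1))}ᶜ
            ⊆ subsetSums A} ≤ Real.exp (-12 * L) * W := by
  obtain ⟨C, hC, L₀, -, h⟩ := exists_forall_pRandomSubset_real_notMem_le d
  refine ⟨C, hC, L₀, ∑' x : Fin d → ℕ, ∏ j, (((x j : ℝ) + 1) ^ 3)⁻¹, fun p L hL hp => ?_⟩
  set R := {x : Fin d → ℕ | ∏ j, ((x j : ℝ) + L) ≤ C * (Real.exp L * L ^ (d + 1))}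
  have hnn : ∀ x : Fin d → ℕ, 0 ≤ Real.exp (-12 * L) * ∏ j, (((x j : ℝ) + 1) ^ 3)⁻¹ :=
    fun x => by positivity
  rw [← tsum_mul_left]
  refine ENNReal.toReal_le_of_le_ofReal (tsum_nonneg hnn) ?_
  rw [ENNReal.ofReal_tsum_of_nonneg hnn ((summable_prod_inv_pow_three d).mul_left _)]
  calc pRandomSubset d p {A | ¬ Rᶜ ⊆ subsetSums A}
      ≤ pRandomSubset d p (⋃ x : Fin d → ℕ, {A | x ∈ Rᶜ ∧ x ∉ subsetSums A}) := by
        refine measure_mono fun A hA => ?_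
        obtain ⟨x, hx⟩ := Set.not_subset.1 hA
        exact Set.mem_iUnion.2 ⟨x, hx⟩
    _ ≤ ∑' x : Fin d → ℕ, pRandomSubset d p {A | x ∈ Rᶜ ∧ x ∉ subsetSums A} :=
        measure_iUnion_le _
    _ ≤ _ := by
        refine ENNReal.tsum_le_tsum fun x => ?_
        by_cases hx : x ∈ Rᶜ
        · rw [← ENNReal.ofReal_toReal (measure_ne_top (pRandomSubset d p) _)]
          simp only [hx, true_and]
          exact ENNReal.ofReal_le_ofReal (h p L hL hp x (not_le.1 hx))
        · simp [hx]

/-! ### Points below the shifted hyperboloid -/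

lemma inv_one_sub_exp_neg_le {t : ℝ} (h0 : 0 < t) (h1 : t ≤ 1) :
    (1 - Real.exp (-t))⁻¹ ≤ 2 / t := by
  have h2 : Real.exp (-t) ≤ (t + 1)⁻¹ := by
    rw [Real.exp_neg]
    gcongr
    exact Real.add_one_le_exp t
  have h3 : t / 2 ≤ 1 - Real.exp (-t) := by
    have : t / 2 ≤ 1 - (t + 1)⁻¹ := by
      have h4 : 1 - (t + 1)⁻¹ = t / (t + 1) := by field_simp; ring
      rw [h4]
      gcongr
      linarith
    linarith
  calc (1 - Real.exp (-t))⁻¹ ≤ (t / 2)⁻¹ := by gcongr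
    _ = 2 / t := by rw [inv_div]

/-- The probability that a nonzero point below the shifted hyperboloid is a subset sum of a random
set. -/
lemma pRandomSubset_real_mem_le_exp {d : ℕ} (hd : 1 ≤ d) {p : unitInterval} {L : ℝ} (hL : 0 < L)
    (hp : (p : ℝ) = Real.exp (-L)) {c : ℝ} (hc : c * (4 * (8 * d) ^ d) ≤ 1)
    {x : Fin d → ℕ} (hx : x ≠ 0) (hxc : ∏ j, ((x j : ℝ) + L) ≤ c * (Real.exp L * L ^ (d + 1))) :
    (pRandomSubset d p).real {A | x ∈ subsetSums A} ≤ Real.exp (-L / 2) := by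
  have hd' : (1 : ℝ) ≤ d := by exact_mod_cast hd
  -- This tilt makes both terms of the exponent at most L/4; together with the prefactor p = e^{-L}
  -- this leaves e^{-L/2}.
  set t : Fin d → ℝ := fun j => L / (4 * d) / (x j + L) with ht
  have htpos : ∀ j, 0 < t j := fun j => by positivity
  have ht1 : ∀ j, t j ≤ 1 := fun j => by
    simp only [ht]
    rw [div_div, div_le_one (by positivity)]
    have : (0 : ℝ) ≤ x j := by positivity
    nlinarith
  refine (pRandomSubset_real_mem_le p hx htpos).trans ?_
  have h1 : ∑ j, t j * x j ≤ L / 4 := by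
    calc ∑ j, t j * x j ≤ ∑ _j : Fin d, L / (4 * d) := by
          refine Finset.sum_le_sum fun j _ => ?_
          simp only [ht]
          rw [div_mul_eq_mul_div, div_le_iff₀ (by positivity)]
          gcongr
          linarith
      _ = L / 4 := by
          simp only [Finset.sum_const, Finset.card_univ, Fintype.card_fin, nsmul_eq_mul]
          field_simp
  have h2 : p * ∏ j, (1 - Real.exp (-t j))⁻¹ ≤ L / 4 := by
    calc (p : ℝ) * ∏ j, (1 - Real.exp (-t j))⁻¹ ≤ p * ∏ j, 2 / t j := by
          refine mul_le_mul_of_nonneg_left (Finset.prod_le_prod (fun j _ => ?_)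
            fun j _ => inv_one_sub_exp_neg_le (htpos j) (ht1 j)) p.2.1
          have : Real.exp (-t j) ≤ 1 := Real.exp_le_one_iff.2 (by linarith [htpos j])
          exact inv_nonneg.2 (by linarith)
      _ = p * ((8 * d / L) ^ d * ∏ j, ((x j : ℝ) + L)) := by
          congr 1
          have : ((8 * d / L) ^ d : ℝ) = ∏ _j : Fin d, (8 * d / L : ℝ) := by
            rw [Finset.prod_const, Finset.card_univ, Fintype.card_fin]
          rw [this, ← Finset.prod_mul_distrib]
          refine Finset.prod_congr rfl fun j _ => ?_
          simp only [ht]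
          field_simp
          ring
      _ ≤ Real.exp (-L) * ((8 * d / L) ^ d * (c * (Real.exp L * L ^ (d + 1)))) := by
          rw [hp]
          gcongr
      _ = c * (4 * (8 * d) ^ d) * (L / 4) := by
          rw [Real.exp_neg, div_pow, pow_succ]
          field_simp
      _ ≤ 1 * (L / 4) := by gcongr
      _ = L / 4 := one_mul _
  calc (p : ℝ) * Real.exp (∑ j, t j * x j + p * ∏ j, (1 - Real.exp (-t j))⁻¹)
      ≤ Real.exp (-L) * Real.exp (L / 4 + L / 4) := by
        rw [hp] at h2 ⊢
        gcongr
    _ = Real.exp (-L / 2) := by rw [← Real.exp_add]; ring_nf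

open Classical in
/-- Markov's inequality for the number of events that occur. -/
lemma mul_measureReal_le_card_mul {Ω ι : Type*} [MeasurableSpace Ω] (μ : Measure Ω)
    [IsFiniteMeasure μ] (s : Finset ι) (E : ι → Set Ω) {δ k : ℝ} (hk : 0 ≤ k)
    (hE : ∀ i ∈ s, μ.real (E i) ≤ δ) :
    k * μ.real {ω | k ≤ ({i ∈ s | ω ∈ E i}.card : ℝ)} ≤ s.card * δ := by
  -- Measurable hulls have the same measure, so the events themselves need not be measurable.
  set f : Ω → ℝ := fun ω => ∑ i ∈ s, (toMeasurable μ (E i)).indicator 1 ω with hf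
  have hmeas : ∀ i, MeasurableSet (toMeasurable μ (E i)) := fun i => measurableSet_toMeasurable _ _
  have hint : ∀ i, Integrable ((toMeasurable μ (E i)).indicator (1 : Ω → ℝ)) μ :=
    fun i => (integrable_const (1 : ℝ)).indicator (hmeas i)
  have hfint : Integrable f μ := integrable_finsetSum _ fun i _ => hint i
  have hf0 : 0 ≤ᵐ[μ] f := ae_of_all _ fun ω =>
    Finset.sum_nonneg fun i _ => Set.indicator_nonneg (fun _ _ => zero_le_one) _
  have hle : ∀ ω, ({i ∈ s | ω ∈ E i}.card : ℝ) ≤ f ω := fun ω => by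
    rw [Finset.card_filter, Nat.cast_sum]
    refine Finset.sum_le_sum fun i _ => ?_
    by_cases h : ω ∈ E i
    · simp [h, subset_toMeasurable μ (E i) h]
    · simp only [h, if_false, Nat.cast_zero]
      exact Set.indicator_nonneg (fun _ _ => zero_le_one) _
  calc k * μ.real {ω | k ≤ ({i ∈ s | ω ∈ E i}.card : ℝ)} ≤ k * μ.real {ω | k ≤ f ω} := by
        refine mul_le_mul_of_nonneg_left (measureReal_mono fun ω hω => ?_) hk
        exact le_trans hω (hle ω)
    _ ≤ ∫ ω, f ω ∂μ := mul_meas_ge_le_integral_of_nonneg hf0 hfint k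
    _ = ∑ i ∈ s, μ.real (E i) := by
        rw [hf, integral_finsetSum _ fun i _ => hint i]
        refine Finset.sum_congr rfl fun i _ => ?_
        rw [integral_indicator_one (hmeas i), measureReal_def, measure_toMeasurable,
          ← measureReal_def]
    _ ≤ _ := by
        rw [← nsmul_eq_mul]
        exact Finset.sum_le_card_nsmul _ _ _ hE

/-! ### Counting lattice points under the shifted hyperboloid -/

/-- The lattice points `x ≥ 0` with `∏ (x j + L) ≤ z`. -/
def shiftedRegion (d : ℕ) (L z : ℝ) : Set (Fin d → ℕ) := {x | ∏ j, ((x j : ℝ) + L) ≤ z}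

lemma sum_range_inv_add_le {L : ℝ} (hL : 1 ≤ L) (N : ℕ) :
    ∑ k ∈ Finset.range N, ((k : ℝ) + L)⁻¹ ≤ 1 + Real.log N := by
  refine le_trans ?_ (harmonic_le_one_add_log N)
  rw [harmonic, Rat.cast_sum]
  refine Finset.sum_le_sum fun k _ => ?_
  push_cast
  gcongr

lemma log_le_sum_range_inv_add {L : ℝ} (hL : 0 < L) (N : ℕ) :
    Real.log ((N + L) / L) ≤ ∑ k ∈ Finset.range N, ((k : ℝ) + L)⁻¹ := by
  induction N with
  | zero => simp [hL.ne']
  | succ N ih =>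
    rw [Finset.sum_range_succ]
    have hpos : 0 < (N : ℝ) + L := by positivity
    have h1 : Real.log (((N + 1 : ℕ) + L) / L)
        = Real.log ((N + L) / L) + Real.log (1 + ((N : ℝ) + L)⁻¹) := by
      rw [← Real.log_mul (by positivity) (by positivity)]
      congr 1
      push_cast
      field_simp
      ring
    rw [h1]
    have h2 := Real.log_le_sub_one_of_pos (show 0 < 1 + ((N : ℝ) + L)⁻¹ by positivity)
    linarith

/-- All factors are at least 1, so each coordinate is at most z. Once the tail is fixed, x_0 + 1 ≤
x_0 + L bounds the first coordinate strictly below the floor. -/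
lemma shiftedRegion_subset_image_cons {n : ℕ} {L z : ℝ} (hL : 1 ≤ L) :
    shiftedRegion (n + 1) L z ⊆
      (((Fintype.piFinset fun _ : Fin n => Finset.range (⌊z⌋₊ + 1)).sigma fun y =>
        Finset.range ⌊z / ∏ j, ((y j : ℝ) + L)⌋₊).image
        fun q : (_ : Fin n → ℕ) × ℕ => (Fin.cons q.2 q.1 : Fin (n + 1) → ℕ) :
          Finset (Fin (n + 1) → ℕ)) := by
  intro x hx
  have hx' : ∏ j, ((x j : ℝ) + L) ≤ z := hx
  rw [Finset.coe_image]
  refine ⟨⟨fun j => x j.succ, x 0⟩, ?_, Fin.cons_self_tail x⟩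
  simp only [Finset.coe_sigma, Set.mem_sigma_iff, Finset.mem_coe, Fintype.mem_piFinset,
    Finset.mem_range]
  have hone : ∀ j, 1 ≤ (x j : ℝ) + L := fun j => by
    have : (0 : ℝ) ≤ x j := by positivity
    linarith
  constructor
  · intro j
    rw [Nat.lt_succ_iff]
    refine Nat.le_floor (le_trans ?_ hx')
    calc (x j.succ : ℝ) ≤ x j.succ + L := by linarith
      _ ≤ _ := by
        rw [← Finset.mul_prod_erase _ _ (Finset.mem_univ j.succ)]
        refine le_mul_of_one_le_right (by linarith [hone j.succ]) ?_
        simpa using Finset.prod_le_prod (s := Finset.univ.erase j.succ) (f := fun _ => (1 : ℝ))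
          (fun _ _ => zero_le_one) fun i _ => hone i
  · rw [← Nat.succ_le_iff]
    refine Nat.le_floor ?_
    rw [le_div_iff₀ (Finset.prod_pos fun j _ => by linarith [hone j.succ])]
    rw [Fin.prod_univ_succ] at hx'
    refine le_trans ?_ hx'
    refine mul_le_mul_of_nonneg_right ?_ (Finset.prod_nonneg fun j _ => by linarith [hone j.succ])
    push_cast
    linarith

lemma finite_shiftedRegion {d : ℕ} (hd : 1 ≤ d) {L z : ℝ} (hL : 1 ≤ L) :
    (shiftedRegion d L z).Finite := by
  obtain ⟨n, rfl⟩ := Nat.exists_eq_add_of_le' hd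
  exact (Finset.finite_toSet _).subset (shiftedRegion_subset_image_cons hL)

lemma ncard_shiftedRegion_le {n : ℕ} {L z : ℝ} (hL : 1 ≤ L) (hz : 0 ≤ z) :
    ((shiftedRegion (n + 1) L z).ncard : ℝ) ≤ z * (1 + Real.log (⌊z⌋₊ + 1 : ℕ)) ^ n := by
  set Y := Fintype.piFinset fun _ : Fin n => Finset.range (⌊z⌋₊ + 1)
  calc ((shiftedRegion (n + 1) L z).ncard : ℝ)
      ≤ ((Y.sigma fun y => Finset.range ⌊z / ∏ j, ((y j : ℝ) + L)⌋₊).card : ℝ) := by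
        have h := Set.ncard_le_ncard (shiftedRegion_subset_image_cons (n := n) (z := z) hL)
          (Finset.finite_toSet _)
        rw [Set.ncard_coe_finset] at h
        exact_mod_cast h.trans Finset.card_image_le
    _ ≤ ∑ y ∈ Y, z * ∏ j, ((y j : ℝ) + L)⁻¹ := by
        rw [Finset.card_sigma, Nat.cast_sum]
        refine Finset.sum_le_sum fun y _ => ?_
        rw [Finset.card_range, Finset.prod_inv_distrib, ← div_eq_mul_inv]
        exact Nat.floor_le (by positivity)
    _ = z * ∏ _j : Fin n, ∑ k ∈ Finset.range (⌊z⌋₊ + 1), ((k : ℝ) + L)⁻¹ := by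
        rw [← Finset.mul_sum, Finset.prod_univ_sum]
    _ ≤ _ := by
        rw [Finset.prod_const, Finset.card_univ, Fintype.card_fin]
        gcongr
        exact sum_range_inv_add_le hL _

/-- For tails in [0, Q)^n the quotient z / ∏ (y_j + L) is at least 2L, so subtracting the shift L
costs at most half of it. -/
lemma le_ncard_shiftedRegion {n Q : ℕ} {L z : ℝ} (hL : 1 ≤ L)
    (hz : 2 * L * (Q + L) ^ n ≤ z) :
    z / 2 * Real.log ((Q + L) / L) ^ n ≤ ((shiftedRegion (n + 1) L z).ncard : ℝ) := by
  set Y := Fintype.piFinset fun _ : Fin n => Finset.range Q with hY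
  have hz0 : 0 ≤ z := le_trans (by positivity) hz
  have hw : ∀ y ∈ Y, 2 * L ≤ z / ∏ j, ((y j : ℝ) + L) := fun y hy => by
    rw [le_div_iff₀ (Finset.prod_pos fun j _ => by positivity)]
    refine le_trans ?_ hz
    gcongr
    have : ((Q : ℝ) + L) ^ n = ∏ _j : Fin n, ((Q : ℝ) + L) := by simp
    rw [this]
    refine Finset.prod_le_prod (fun j _ => by positivity) fun j _ => ?_
    gcongr
    exact (Finset.mem_range.1 (Fintype.mem_piFinset.1 hy j)).le
  have hlog : 0 ≤ Real.log ((Q + L) / L) := Real.log_nonneg <| by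
    rw [one_le_div (by positivity)]
    simp
  calc z / 2 * Real.log ((Q + L) / L) ^ n
      ≤ z / 2 * ∏ _j : Fin n, ∑ k ∈ Finset.range Q, ((k : ℝ) + L)⁻¹ := by
        rw [Finset.prod_const, Finset.card_univ, Fintype.card_fin]
        gcongr
        exact log_le_sum_range_inv_add (by linarith) Q
    _ = ∑ y ∈ Y, z / 2 * ∏ j, ((y j : ℝ) + L)⁻¹ := by
        rw [← Finset.mul_sum, Finset.prod_univ_sum]
    _ ≤ ∑ y ∈ Y, ((⌊z / ∏ j, ((y j : ℝ) + L) - L⌋₊ + 1 : ℕ) : ℝ) := by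
        refine Finset.sum_le_sum fun y hy => ?_
        have h1 := hw y hy
        have h2 := Nat.lt_floor_add_one (z / ∏ j, ((y j : ℝ) + L) - L)
        rw [Finset.prod_inv_distrib, div_mul_eq_mul_div, ← div_eq_mul_inv]
        push_cast
        linarith
    _ = (((Y.sigma fun y => Finset.range (⌊z / ∏ j, ((y j : ℝ) + L) - L⌋₊ + 1)).image
          fun q : (_ : Fin n → ℕ) × ℕ => (Fin.cons q.2 q.1 : Fin (n + 1) → ℕ)).card : ℝ) := by
        rw [Finset.card_image_of_injective, Finset.card_sigma]
        · push_cast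
          simp
        · rintro ⟨y, a⟩ ⟨y', a'⟩ h
          obtain ⟨h1, h2⟩ := Fin.cons_injective2 h
          simp_all
    _ ≤ _ := by
        rw [← Set.ncard_coe_finset]
        refine Nat.cast_le.2 (Set.ncard_le_ncard ?_ (finite_shiftedRegion (by omega) hL))
        intro x hx
        obtain ⟨⟨y, a⟩, hq, rfl⟩ := Finset.mem_image.1 (Finset.mem_coe.1 hx)
        simp only [Finset.mem_sigma, Finset.mem_range, Nat.lt_succ_iff] at hq
        obtain ⟨hy, ha⟩ := hq
        have h1 := hw y hy
        have h2 : (a : ℝ) ≤ z / ∏ j, ((y j : ℝ) + L) - L :=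
          (Nat.le_floor_iff (by linarith)).1 ha
        change ∏ j, (((Fin.cons a y : Fin (n + 1) → ℕ) j : ℝ) + L) ≤ z
        rw [Fin.prod_univ_succ]
        simp only [Fin.cons_zero, Fin.cons_succ]
        rw [← le_div_iff₀ (Finset.prod_pos fun j _ => by positivity)]
        linarith

lemma eventually_ncard_shiftedRegion_le {d : ℕ} (hd : 1 ≤ d) {C : ℝ} (hC : 0 < C) :
    ∀ᶠ L : ℝ in atTop, ((shiftedRegion d L (C * (Real.exp L * L ^ (d + 1)))).ncard : ℝ)
      ≤ C * (d + 5) ^ d * (Real.exp L * L ^ (2 * d)) := by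
  obtain ⟨n, rfl⟩ := Nat.exists_eq_add_of_le' hd
  filter_upwards [eventually_ge_atTop 1, eventually_ge_atTop (C + 1)] with L hL hLC
  have hexp : 1 ≤ Real.exp L := Real.one_le_exp (by linarith)
  set z := C * (Real.exp L * L ^ (n + 1 + 1)) with hz
  have hz0 : 0 ≤ z := by positivity
  refine (ncard_shiftedRegion_le hL hz0).trans ?_
  have h1 : 1 + Real.log (⌊z⌋₊ + 1 : ℕ) ≤ (n + 6) * L := by
    have h2 : ((⌊z⌋₊ + 1 : ℕ) : ℝ) ≤ Real.exp L * L ^ (n + 3) := by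
      push_cast
      have h3 := Nat.floor_le hz0
      have h4 : 1 ≤ Real.exp L * L ^ (n + 2) :=
        one_le_mul_of_one_le_of_one_le hexp (one_le_pow₀ hL)
      calc (⌊z⌋₊ : ℝ) + 1 ≤ C * (Real.exp L * L ^ (n + 2)) + Real.exp L * L ^ (n + 2) :=
            add_le_add h3 h4
        _ = (C + 1) * (Real.exp L * L ^ (n + 2)) := by ring
        _ ≤ L * (Real.exp L * L ^ (n + 2)) := by gcongr
        _ = _ := by ring
    have h5 := Real.log_le_log (by positivity) h2
    rw [Real.log_mul (by positivity) (by positivity), Real.log_exp, Real.log_pow] at h5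
    have h6 : ((n + 3 : ℕ) : ℝ) * Real.log L ≤ (n + 3 : ℕ) * L := by
      gcongr
      exact Real.log_le_self (by linarith)
    push_cast at h5 h6 ⊢
    linarith
  have h7 : 0 ≤ 1 + Real.log (⌊z⌋₊ + 1 : ℕ) := by
    have := Real.log_natCast_nonneg (⌊z⌋₊ + 1)
    linarith
  calc z * (1 + Real.log (⌊z⌋₊ + 1 : ℕ)) ^ n ≤ z * ((n + 6) * L) ^ n := by gcongr
    _ = C * (n + 6) ^ n * (Real.exp L * L ^ (2 * (n + 1))) := by
        rw [hz, mul_pow]; ring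
    _ ≤ C * (n + 6) ^ (n + 1) * (Real.exp L * L ^ (2 * (n + 1))) := by
        gcongr
        · linarith
        · omega
    _ = _ := by push_cast; ring

lemma eventually_le_ncard_shiftedRegion {d : ℕ} (hd : 1 ≤ d) {c : ℝ} (hc : 0 < c) :
    ∀ᶠ L : ℝ in atTop, c / (2 * (4 * d) ^ d) * (Real.exp L * L ^ (2 * d)) ≤
      ((shiftedRegion d L (c * (Real.exp L * L ^ (d + 1)))).ncard : ℝ) := by
  obtain ⟨n, rfl⟩ := Nat.exists_eq_add_of_le' hd
  -- With Q about e^{2rL}, Q^n stays below e^L, while (Q + L)/L ≥ e^{rL} still has logarithm of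
  -- order L.
  set r : ℝ := 1 / (4 * (n + 1 : ℕ)) with hr
  have hrpos : 0 < r := by positivity
  have hlim : Tendsto (fun L : ℝ => Real.exp (r * L)) atTop atTop :=
    Real.tendsto_exp_atTop.comp (tendsto_id.const_mul_atTop hrpos)
  have hlo : ∀ᶠ L : ℝ in atTop, L ≤ Real.exp (r * L) := by
    have h := ((isLittleO_pow_exp_pos_mul_atTop 1 hrpos).bound one_pos)
    filter_upwards [h, eventually_ge_atTop 0] with L hL h0
    simpa [abs_of_nonneg h0] using hL
  filter_upwards [eventually_ge_atTop 1, hlo, eventually_ge_atTop (2 * 2 ^ n / c)]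
    with L hL hLexp hLc
  have hLpos : 0 < L := by linarith
  set q := Real.exp (2 * r * L) with hq
  have hqsq : q = Real.exp (r * L) * Real.exp (r * L) := by
    rw [hq, ← Real.exp_add]; ring_nf
  have hqL : L ≤ q := by
    rw [hqsq]
    nlinarith
  set Q := ⌊q⌋₊ with hQ
  have hQle : (Q : ℝ) ≤ q := Nat.floor_le (Real.exp_pos _).le
  have hQge : q < Q + 1 := Nat.lt_floor_add_one q
  have hlog : r * L ≤ Real.log ((Q + L) / L) := by
    rw [Real.le_log_iff_exp_le (by positivity), le_div_iff₀ hLpos]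
    calc Real.exp (r * L) * L ≤ q := by rw [hqsq]; gcongr
      _ ≤ Q + L := by linarith
  have hqn : q ^ n ≤ Real.exp L := by
    rw [hq, ← Real.exp_nat_mul]
    gcongr
    have : (n : ℝ) * (2 * r) ≤ 1 := by
      rw [hr]
      push_cast
      rw [mul_one_div, ← mul_div_assoc, div_le_one (by positivity)]
      have : (0 : ℝ) ≤ n := by positivity
      linarith
    calc (n : ℝ) * (2 * r * L) = n * (2 * r) * L := by ring
      _ ≤ 1 * L := by gcongr
      _ = L := one_mul L
  have hz : 2 * L * (Q + L) ^ n ≤ c * (Real.exp L * L ^ (n + 1 + 1)) := by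
    calc 2 * L * (Q + L) ^ n ≤ 2 * L * (2 * q) ^ n := by gcongr; linarith
      _ = (2 * 2 ^ n) * L * q ^ n := by rw [mul_pow]; ring
      _ ≤ (c * L) * L * Real.exp L := by
          rw [div_le_iff₀' hc] at hLc
          gcongr ?_ * L * ?_
      _ = c * (Real.exp L * L ^ 2) := by ring
      _ ≤ _ := by
          gcongr
          omega
  refine le_trans ?_ (le_ncard_shiftedRegion hL hz)
  calc c / (2 * (4 * (n + 1 : ℕ)) ^ (n + 1)) * (Real.exp L * L ^ (2 * (n + 1)))
      ≤ c / (2 * (4 * (n + 1 : ℕ)) ^ n) * (Real.exp L * L ^ (2 * (n + 1))) := by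
        gcongr
        · push_cast
          have : (0 : ℝ) ≤ n := by positivity
          linarith
        · omega
    _ = c * (Real.exp L * L ^ (n + 1 + 1)) / 2 * (r * L) ^ n := by
        rw [mul_pow r, hr, one_div, inv_pow]
        field_simp
        ring
    _ ≤ _ := by gcongr

/-! ### Sparsity of the subset sums below the hyperboloid -/

lemma pRandomSubset_real_many_subsetSums_le {d : ℕ} (hd : 1 ≤ d) {p : unitInterval} {L : ℝ}
    (hL : 0 < L) (hp : (p : ℝ) = Real.exp (-L)) {c : ℝ} (hc : c * (4 * (8 * d) ^ d) ≤ 1)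
    (hfin : (shiftedRegion d L (c * (Real.exp L * L ^ (d + 1)))).Finite)
    (hlarge : Real.exp (L / 4)
      ≤ ((shiftedRegion d L (c * (Real.exp L * L ^ (d + 1)))).ncard : ℝ)) :
    (pRandomSubset d p).real {A | ¬ ((subsetSums A ∩
        shiftedRegion d L (c * (Real.exp L * L ^ (d + 1)))).ncard : ℝ)
          ≤ 2 * Real.exp (-L / 4) * (shiftedRegion d L (c * (Real.exp L * L ^ (d + 1)))).ncard}
      ≤ Real.exp (-L / 4) := by
  classical
  set R := shiftedRegion d L (c * (Real.exp L * L ^ (d + 1))) with hR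
  -- The origin is always a subset sum; it is counted separately, and 1 ≤ k absorbs it into the
  -- factor 2.
  set s := hfin.toFinset.erase 0 with hs
  have hN : 0 < (R.ncard : ℝ) := (Real.exp_pos _).trans_le hlarge
  have hscard : (s.card : ℝ) ≤ R.ncard := by
    rw [Set.ncard_eq_toFinset_card _ hfin]
    exact_mod_cast Finset.card_erase_le
  set k := Real.exp (-L / 4) * R.ncard with hk
  have hkpos : 0 < k := by positivity
  have hk1 : 1 ≤ k := by
    calc (1 : ℝ) = Real.exp (-L / 4) * Real.exp (L / 4) := by
          rw [← Real.exp_add, ← add_div, neg_add_cancel, zero_div, Real.exp_zero]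
      _ ≤ k := by rw [hk]; gcongr
  have hmarkov := mul_measureReal_le_card_mul (pRandomSubset d p) s
    (fun x => {A | x ∈ subsetSums A}) hkpos.le fun x hx => by
      rw [hs, Finset.mem_erase, Set.Finite.mem_toFinset] at hx
      exact pRandomSubset_real_mem_le_exp hd hL hp hc hx.1 hx.2
  have hexp : Real.exp (-L / 2) = Real.exp (-L / 4) * Real.exp (-L / 4) := by
    rw [← Real.exp_add]; ring_nf
  have hbound : (pRandomSubset d p).real {A | k ≤ ({x ∈ s | x ∈ subsetSums A}.card : ℝ)}
      ≤ Real.exp (-L / 4) := by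
    refine le_of_mul_le_mul_left (hmarkov.trans ?_) hkpos
    rw [hexp, hk]
    calc (s.card : ℝ) * (Real.exp (-L / 4) * Real.exp (-L / 4))
        ≤ R.ncard * (Real.exp (-L / 4) * Real.exp (-L / 4)) := by gcongr
      _ = _ := by ring
  refine (measureReal_mono fun A hA => ?_).trans hbound
  simp only [Set.mem_ofPred_eq, not_le] at hA ⊢
  have hsub : subsetSums A ∩ R ⊆ ((insert 0 {x ∈ s | x ∈ subsetSums A} : Finset (Fin d → ℕ)) :
      Set (Fin d → ℕ)) := by
    rintro x ⟨hxA, hxR⟩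
    by_cases hx : x = 0
    · simp [hx]
    · simp [hs, hx, hxA, hxR]
  have hle : ((subsetSums A ∩ R).ncard : ℝ) ≤ ({x ∈ s | x ∈ subsetSums A}.card : ℝ) + 1 := by
    have h := Set.ncard_le_ncard hsub (Finset.finite_toSet _)
    rw [Set.ncard_coe_finset] at h
    exact_mod_cast h.trans (Finset.card_insert_le _ _)
  have : 2 * Real.exp (-L / 4) * R.ncard = 2 * k := by rw [hk]; ring
  linarith

/-! ### Passage to the limit and conclusion -/

lemma tendsto_log_inv_unitInterval :
    Tendsto (fun p : unitInterval => Real.log (p : ℝ)⁻¹) (𝓝[>] 0) atTop := by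
  refine Real.tendsto_log_atTop.comp (tendsto_inv_nhdsGT_zero.comp ?_)
  refine tendsto_nhdsWithin_iff.2 ⟨?_, ?_⟩
  · exact (continuous_subtype_val.tendsto (0 : unitInterval)).mono_left nhdsWithin_le_nhds
  · filter_upwards [self_mem_nhdsWithin] with p hp
    exact hp

/-- Subadditivity alone suffices, so no measurability of the events is required. -/
lemma le_measureReal_of_compl_le {Ω : Type*} [MeasurableSpace Ω] (μ : Measure Ω)
    [IsProbabilityMeasure μ] {s t u : Set Ω} {a b : ℝ} (h : ∀ ω, ω ∉ t → ω ∉ u → ω ∈ s)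
    (ht : μ.real t ≤ a) (hu : μ.real u ≤ b) : 1 - (a + b) ≤ μ.real s := by
  have h1 : (Set.univ : Set Ω) ⊆ s ∪ (t ∪ u) := fun ω _ => by
    by_cases h1 : ω ∈ t
    · exact Or.inr (Or.inl h1)
    · by_cases h2 : ω ∈ u
      · exact Or.inr (Or.inr h2)
      · exact Or.inl (h ω h1 h2)
  have h2 := measureReal_mono h1 (measure_ne_top μ _)
  rw [probReal_univ] at h2
  have h3 := measureReal_union_le (μ := μ) s (t ∪ u)
  have h4 := measureReal_union_le (μ := μ) t u
  linarith

lemma gap_estimates {d : ℕ} {G R₁ R₂ : Set (Fin d → ℕ)} {e a b : ℝ}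
    (he : e ≤ 1 / 2) (hR₁ : R₁.Finite) (hR₂ : R₂.Finite)
    (ha : a ≤ R₁.ncard) (hb : R₂.ncard ≤ b)
    (h1 : ((G ∩ R₁).ncard : ℝ) ≤ e * R₁.ncard) (h2 : R₂ᶜ ⊆ G) :
    Gᶜ.Finite ∧ a / 2 ≤ (Gᶜ.ncard : ℝ) ∧ (Gᶜ.ncard : ℝ) ≤ b := by
  have hsub : Gᶜ ⊆ R₂ := Set.compl_subset_comm.1 h2
  have hfin : Gᶜ.Finite := hR₂.subset hsub
  refine ⟨hfin, ?_, le_trans (Nat.cast_le.2 (Set.ncard_le_ncard hsub hR₂)) hb⟩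
  have h3 : R₁ ⊆ (G ∩ R₁) ∪ Gᶜ := fun x hx => by
    by_cases h : x ∈ G
    · exact Or.inl ⟨h, hx⟩
    · exact Or.inr h
  have h4 : (R₁.ncard : ℝ) ≤ (G ∩ R₁).ncard + Gᶜ.ncard := by
    exact_mod_cast (Set.ncard_le_ncard h3 ((hR₁.inter_of_right G).union hfin)).trans
      (Set.ncard_union_le _ _)
  have h5 : e * R₁.ncard ≤ 1 / 2 * R₁.ncard := by gcongr
  linarith

theorem theorem1p3 (d : ℕ) (hd : 1 ≤ d) :
    ∃ C : ℝ, 0 < C ∧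
    ∃ ε : unitInterval → ℝ, Tendsto ε (𝓝[>] 0) (𝓝 0) ∧
    ∃ c₁ c₂ : ℝ, 0 < c₁ ∧ 0 < c₂ ∧
      WithHighProbability d (fun p A =>
        ((subsetSums A ∩ hyperboloidRegion d p (C⁻¹ * gapScale d p)).ncard : ℝ)
            ≤ ε p * ((hyperboloidRegion d p (C⁻¹ * gapScale d p)).ncard : ℝ) ∧
        (hyperboloidRegion d p (C * gapScale d p))ᶜ ⊆ subsetSums A ∧
        (subsetSums A)ᶜ.Finite ∧
        c₁ * ((p : ℝ)⁻¹ * Real.log (p : ℝ)⁻¹ ^ (2 * d)) ≤ ((subsetSums A)ᶜ.ncard : ℝ) ∧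
        ((subsetSums A)ᶜ.ncard : ℝ) ≤ c₂ * ((p : ℝ)⁻¹ * Real.log (p : ℝ)⁻¹ ^ (2 * d))) := by
  obtain ⟨C₀, hC₀, L₀, W, habove⟩ := exists_forall_pRandomSubset_real_not_compl_subset_le d
  have hd' : (0 : ℝ) < d := by exact_mod_cast hd
  -- One constant serves both sides: C ≥ C₀ for covering, and C⁻¹ small enough for the first-moment
  -- bound.
  set C := max C₀ (4 * (8 * d) ^ d) with hC
  have hCpos : 0 < C := lt_max_of_lt_left hC₀
  have hCinv : C⁻¹ * (4 * (8 * d) ^ d) ≤ 1 := by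
    rw [inv_mul_le_iff₀ hCpos, mul_one]
    exact le_max_right _ _
  have hdecay : ∀ r : ℝ, 0 < r → Tendsto (fun L : ℝ => Real.exp (-(r * L))) atTop (𝓝 0) :=
    fun r hr => Real.tendsto_exp_neg_atTop_nhds_zero.comp (tendsto_id.const_mul_atTop hr)
  have hε : Tendsto (fun L : ℝ => 2 * Real.exp (-L / 4)) atTop (𝓝 0) := by
    have := (hdecay (1 / 4) (by norm_num)).const_mul 2
    rw [mul_zero] at this
    refine this.congr fun L => ?_
    ring_nf
  have hfail : Tendsto (fun L : ℝ => 1 - (Real.exp (-L / 4) + Real.exp (-12 * L) * W))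
      atTop (𝓝 1) := by
    have := ((hdecay (1 / 4) (by norm_num)).add
      ((hdecay 12 (by norm_num)).mul_const W)).const_sub 1
    rw [zero_mul, add_zero, sub_zero] at this
    refine this.congr fun L => ?_
    ring_nf
  set a : ℝ := C⁻¹ / (2 * (4 * d) ^ d) with ha
  have hapos : 0 < a := by positivity
  refine ⟨C, hCpos, fun p => 2 * Real.exp (-Real.log (p : ℝ)⁻¹ / 4),
    hε.comp tendsto_log_inv_unitInterval, a / 2, C * (d + 5) ^ d, by positivity, by positivity, ?_⟩
  rw [WithHighProbability, ← ENNReal.tendsto_toReal_iff (fun p => measure_ne_top _ _) (by simp),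
    ENNReal.toReal_one]
  refine tendsto_of_tendsto_of_tendsto_of_le_of_le' (hfail.comp tendsto_log_inv_unitInterval)
    tendsto_const_nhds ?_ (Eventually.of_forall fun p => measureReal_le_one)
  have hlarge : ∀ᶠ L : ℝ in atTop, 1 / a ≤ Real.exp L := Real.tendsto_exp_atTop.eventually_ge_atTop _
  have hsmall : ∀ᶠ L : ℝ in atTop, 2 * Real.exp (-L / 4) ≤ 1 / 2 :=
    hε.eventually_le_const (by norm_num)
  have hev := (eventually_ge_atTop (1 : ℝ)).and <| (eventually_ge_atTop L₀).and <|
    (hsmall.and <| (eventually_le_ncard_shiftedRegion hd (inv_pos.2 hCpos)).and <|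
      (eventually_ncard_shiftedRegion_le hd hCpos).and <|
      ((tendsto_id.const_mul_atTop (show (0 : ℝ) < 3 / 4 by norm_num)).eventually hlarge))
  filter_upwards [tendsto_log_inv_unitInterval.eventually hev, self_mem_nhdsWithin]
    with p ⟨hL1, hL₀, hsm, hlow, hup, hexp⟩ hp0
  have hp0' : (0 : ℝ) < p := hp0
  set L := Real.log (p : ℝ)⁻¹ with hLdef
  have hpinv : (p : ℝ)⁻¹ = Real.exp L := (Real.exp_log (inv_pos.2 hp0')).symm
  have hp : (p : ℝ) = Real.exp (-L) := by rw [Real.exp_neg, ← hpinv, inv_inv]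
  have hregion : ∀ Z : ℝ, hyperboloidRegion d p (Z * gapScale d p)
      = shiftedRegion d L (Z * (Real.exp L * L ^ (d + 1))) := fun Z => by
    rw [gapScale, hyperboloidRegion, shiftedRegion, ← hLdef, hpinv]
  have hfin : ∀ z, (shiftedRegion d L z).Finite := fun z => finite_shiftedRegion hd hL1
  have hmany := pRandomSubset_real_many_subsetSums_le hd (by linarith) hp hCinv (hfin _) (by
    refine le_trans ?_ hlow
    rw [div_le_iff₀ hapos] at hexp
    calc Real.exp (L / 4) ≤ Real.exp (L / 4) * (Real.exp (3 / 4 * id L) * a) :=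
          le_mul_of_one_le_right (by positivity) hexp
      _ = a * (Real.exp L * 1) := by
          rw [← mul_assoc, ← Real.exp_add, id, mul_one, mul_comm]
          ring_nf
      _ ≤ a * (Real.exp L * L ^ (2 * d)) := by
          gcongr
          exact one_le_pow₀ hL1)
  refine le_measureReal_of_compl_le _ (fun A h1 h2 => ?_) hmany (habove p L hL₀ hp)
  simp only [Set.mem_ofPred_eq, not_not] at h1 h2 ⊢
  have h2' : (shiftedRegion d L (C * (Real.exp L * L ^ (d + 1))))ᶜ ⊆ subsetSums A := by
    refine (Set.compl_subset_compl.2 fun x hx => ?_).trans h2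
    refine le_trans (show ∏ j, ((x j : ℝ) + L) ≤ _ from hx) ?_
    gcongr
    exact le_max_left _ _
  rw [hregion, hregion, hpinv]
  obtain ⟨h3, h4, h5⟩ := gap_estimates hsm (hfin _) (hfin _) hlow hup h1 h2'
  exact ⟨h1, h2', h3, by linarith, h5⟩
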